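/- Let $N$ be a finite set with $n$ elements and let $f : 2^N \to \mathbb{R}$ be submodular, i.e. $f(S \cup T) + f(S \cap T) \le f(S) + f(T)$ for all $S, T \subseteq N$, with $f(\emptyset) = 0$. For $S \subseteq N$ let $\chi_S \in \{0,1\}^N$ be its indicator vector, and for $\pi, x \in \mathbb{R}^N$ write $\pi(S) = \sum_{i \in S} \pi_i$ and $\pi x = \sum_{i \in N} \pi_i x_i$. Put \[ Q_f = \operatorname{conv}\{(\chi_S, z) : S \subseteq N,\ z \in \mathbb{R},\ f(S) \le z\}, \qquad P_f = \{\pi \in \mathbb{R}^N : \pi(S) \le f(S) \text{ for all } S \subseteq N\}, \] \[ P_f^\circ = \{(x,z) \in \mathbb{R}^N \times \mathbb{R} : \pi x \le z \text{ for all } \pi \in P_f\}. \] An inequality $\pi x \le \alpha z + \pi_0$ (with $\pi \in \mathbb{R}^N$, $\alpha, \pi_0 \in \mathbb{R}$) is facet-defining for $Q_f$ if it holds on $Q_f$ and the set of points of $Q_f$ at which it is an equality is nonempty, of dimension $\dim Q_f - 1$. It is trivial if it is a positive multiple of one of the bounds $-x_i \le 0$, $x_i \le 1$ ($i \in N$).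 The Lovász extension $\hat f : [0,1]^N \to \mathbb{R}$ is defined, for an enumeration $\sigma(1), \dots, \sigma(n)$ of $N$ with $x_{\sigma(1)} \ge \dots \ge x_{\sigma(n)}$ and $S_i = \{\sigma(1), \dots, \sigma(i)\}$, by \[ \hat f(x) = \sum_{i=1}^{n-1} (x_{\sigma(i)} - x_{\sigma(i+1)}) f(S_i) + x_{\sigma(n)} f(S_n) \] (the value does not depend on the choice of $\sigma$; if $n = 0$, it is $0$). Then: 1. Every non-trivial facet-defining inequality $\pi x \le \alpha z + \pi_0$ of $Q_f$ has $\alpha > 0$ and $\pi_0 = 0$. In particular, every non-trivial facet-defining inequality of the form $\pi x \le z + \pi_0$ has $\pi_0 = 0$. 2. $Q_f = P_f^\circ \cap \left([0,1]^N \times \mathbb{R}\right)$. 3. $Q_f = \{(x,z) \in [0,1]^N \times \mathbb{R} : \hat f(x) \le z\}$, the epigraph of $\hat f$. -/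

import Mathlib

/-- A set function on the subsets of a finite ground set is submodular. -/
def IsSubmodularFn {ι : Type*} [DecidableEq ι] (f : Finset ι → ℝ) : Prop :=
  ∀ S T : Finset ι, f (S ∪ T) + f (S ∩ T) ≤ f S + f T

/-- The indicator vector of `S`, a point of `{0,1}^N`. -/
def indVec {ι : Type*} [DecidableEq ι] (S : Finset ι) : ι → ℝ :=
  fun i => if i ∈ S then 1 else 0

/-- The epigraph of a set function over the vertices `{0,1}^N` of the cube. -/
def binaryEpigraph {ι : Type*} [DecidableEq ι] (f : Finset ι → ℝ) : Set ((ι → ℝ) × ℝ) :=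
  {p | ∃ S : Finset ι, p.1 = indVec S ∧ f S ≤ p.2}

/-- `Q_f`: the convex hull of the epigraph of `f` over `{0,1}^N`. -/
def epiHull {ι : Type*} [DecidableEq ι] (f : Finset ι → ℝ) : Set ((ι → ℝ) × ℝ) :=
  convexHull ℝ (binaryEpigraph f)

/-- `P_f`: the polyhedron of all `π` with `π(S) ≤ f(S)` for every `S ⊆ N`. -/
def associatedPolyhedron {ι : Type*} (f : Finset ι → ℝ) : Set (ι → ℝ) :=
  {π | ∀ S : Finset ι, ∑ i ∈ S, π i ≤ f S}

/-- `P_f°`: the polar of `P_f`. -/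
def polarPolyhedron {ι : Type*} [Fintype ι] (f : Finset ι → ℝ) : Set ((ι → ℝ) × ℝ) :=
  {p | ∀ π ∈ associatedPolyhedron f, ∑ i, π i * p.1 i ≤ p.2}

/-- The inequality `π x ≤ α z + π₀` is valid for the set `Q` of points `(x, z)`. -/
def IsValidIneq {ι : Type*} [Fintype ι] (Q : Set ((ι → ℝ) × ℝ))
    (π : ι → ℝ) (α π₀ : ℝ) : Prop :=
  ∀ p ∈ Q, ∑ i, π i * p.1 i ≤ α * p.2 + π₀

/-- The points of `Q` at which `π x ≤ α z + π₀` holds with equality. -/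
def ineqFace {ι : Type*} [Fintype ι] (Q : Set ((ι → ℝ) × ℝ))
    (π : ι → ℝ) (α π₀ : ℝ) : Set ((ι → ℝ) × ℝ) :=
  {p | p ∈ Q ∧ ∑ i, π i * p.1 i = α * p.2 + π₀}

/-- The inequality `π x ≤ α z + π₀` is facet-defining for `Q`: it is valid for `Q`, and the face
of `Q` that it defines is nonempty, of affine dimension `dim Q - 1`. -/
def IsFacetDefining {ι : Type*} [Fintype ι] (Q : Set ((ι → ℝ) × ℝ))
    (π : ι → ℝ) (α π₀ : ℝ) : Prop :=
  IsValidIneq Q π α π₀ ∧ (ineqFace Q π α π₀).Nonempty ∧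
    Module.finrank ℝ (vectorSpan ℝ (ineqFace Q π α π₀)) + 1 =
      Module.finrank ℝ (vectorSpan ℝ Q)

/-- The inequality `π x ≤ α z + π₀` is, up to a positive factor `c`, one of the variable bounds
`-x_i ≤ 0` and `x_i ≤ 1`. -/
def IsTrivialIneq {ι : Type*} [DecidableEq ι] (π : ι → ℝ) (α π₀ : ℝ) : Prop :=
  ∃ (i : ι) (c : ℝ), 0 < c ∧ α = 0 ∧
    ((π = Pi.single i (-c) ∧ π₀ = 0) ∨ (π = Pi.single i c ∧ π₀ = c))

/-- For an enumeration `σ` of the ground set, the sum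
`∑_{i=1}^{n-1} (x_{σ(i)} - x_{σ(i+1)}) f(S_i) + x_{σ(n)} f(S_n)`,
where `S_i = {σ(1), …, σ(i)}` (the indices `1, …, n` are `0, …, n - 1` below). -/
def lovaszSum {ι : Type*} [Fintype ι] [DecidableEq ι] (f : Finset ι → ℝ) (x : ι → ℝ)
    (σ : Fin (Fintype.card ι) ≃ ι) : ℝ :=
  ∑ i : Fin (Fintype.card ι),
    (x (σ i) - if h : (i : ℕ) + 1 < Fintype.card ι then x (σ ⟨i + 1, h⟩) else 0) *
      f ((Finset.Iic i).image σ)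

theorem exists_nonincreasing_enum {ι : Type*} [Fintype ι] (x : ι → ℝ) :
    ∃ σ : Fin (Fintype.card ι) ≃ ι, Antitone (x ∘ σ) := by
  let e := (Fintype.equivFin ι).symm
  refine ⟨(Tuple.sort (fun i => -x (e i))).trans e, fun a b hab => ?_⟩
  have h := Tuple.monotone_sort (fun i => -x (e i)) hab
  simpa using h

/-- The Lovász extension: the sum `lovaszSum` for an enumeration of the ground set in which the
coordinates of `x` are nonincreasing. -/
noncomputable def lovaszExt {ι : Type*} [Fintype ι] [DecidableEq ι] (f : Finset ι → ℝ)
    (x : ι → ℝ) : ℝ :=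
  lovaszSum f x (exists_nonincreasing_enum x).choose

theorem lovaszSum_eq_of_antitone {ι : Type*} [Fintype ι] [DecidableEq ι] (f : Finset ι → ℝ)
    (x : ι → ℝ) {σ τ : Fin (Fintype.card ι) ≃ ι} (hσ : Antitone (x ∘ σ))
    (hτ : Antitone (x ∘ τ)) : lovaszSum f x σ = lovaszSum f x τ := by
  have key : ∀ i, x (σ i) = x (τ i) := by
    have h := Tuple.unique_monotone (f := fun i => -x (σ i)) (σ := Equiv.refl _)
      (τ := τ.trans σ.symm)
      (fun a b hab => by simpa using hσ hab) (fun a b hab => by simpa using hτ hab)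
    intro i
    have := congrFun h i
    simpa using this
  have sub : ∀ {ρ : Fin (Fintype.card ι) ≃ ι}, Antitone (x ∘ ρ) → ∀ i : Fin (Fintype.card ι),
      (∀ h : (i : ℕ) + 1 < Fintype.card ι, x (ρ ⟨i + 1, h⟩) < x (ρ i)) →
      (Finset.Iic i).image ρ = Finset.univ.filter (fun j => x (ρ i) ≤ x j) := by
    intro ρ hρ i hi
    ext j
    simp only [Finset.mem_image, Finset.mem_Iic, Finset.mem_filter, Finset.mem_univ, true_and]
    constructor
    · rintro ⟨k, hk, rfl⟩
      exact hρ hk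
    · intro hj
      refine ⟨ρ.symm j, ?_, by simp⟩
      by_contra hlt
      have hlt' : (i : ℕ) < (ρ.symm j : ℕ) := not_le.mp hlt
      have hn : (i : ℕ) + 1 < Fintype.card ι := lt_of_le_of_lt hlt' (ρ.symm j).2
      have h1 : (⟨i + 1, hn⟩ : Fin (Fintype.card ι)) ≤ ρ.symm j := hlt'
      have h2 := hρ h1
      simp only [Function.comp_apply, Equiv.apply_symm_apply] at h2
      linarith [hi hn]
  unfold lovaszSum
  refine Finset.sum_congr rfl fun i _ => ?_
  by_cases hi : ∀ h : (i : ℕ) + 1 < Fintype.card ι, x (σ ⟨i + 1, h⟩) < x (σ i)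
  · have hi' : ∀ h : (i : ℕ) + 1 < Fintype.card ι, x (τ ⟨i + 1, h⟩) < x (τ i) := by
      intro h
      rw [← key, ← key]
      exact hi h
    rw [sub hσ i hi, sub hτ i hi']
    simp only [key]
  · push Not at hi
    obtain ⟨h, hle⟩ := hi
    have hge : x (σ ⟨i + 1, h⟩) ≤ x (σ i) := hσ (Fin.mk_le_mk.mpr (Nat.le_succ _))
    have heq : x (σ i) = x (σ ⟨i + 1, h⟩) := le_antisymm hle hge
    have heq' : x (τ i) = x (τ ⟨i + 1, h⟩) := by rw [← key, ← key, heq]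
    simp only [h, dite_true, heq, heq', sub_self, zero_mul]

/-- The Lovász extension can be computed with any nonincreasing enumeration. -/
theorem lovaszExt_eq {ι : Type*} [Fintype ι] [DecidableEq ι] (f : Finset ι → ℝ)
    (x : ι → ℝ) (σ : Fin (Fintype.card ι) ≃ ι) (hσ : Antitone (x ∘ σ)) :
    lovaszExt f x = lovaszSum f x σ :=
  lovaszSum_eq_of_antitone f x (exists_nonincreasing_enum x).choose_spec hσ

/-- The epigraph of the Lovász extension over its domain `[0,1]^N`. -/
def lovaszEpigraph {ι : Type*} [Fintype ι] [DecidableEq ι] (f : Finset ι → ℝ) :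
    Set ((ι → ℝ) × ℝ) :=
  {p | p.1 ∈ Set.Icc (0 : ι → ℝ) 1 ∧ lovaszExt f p.1 ≤ p.2}

/-!
The three sets coincide by the cyclic inclusion `epiHull f ⊆ polar ∩ cube ⊆ lovaszEpigraph f ⊆
epiHull f`. The first inclusion holds on generators, and the right side is convex. For the second,
order the coordinates of `x` nonincreasingly and let `A_k` be the set of the first `k` elements. The
greedy vector, whose entries are the increments `f (A_{k+1}) - f (A_k)`, belongs to `P_f` by
submodularity (`greedyVec_mem`), and summation by parts (`lovaszSum_eq_sum_greedyVec`) shows that its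
product with `x` is the Lovász extension at `x`. For the third, the nonnegative coefficients in the
Lovász sum, completed by a weight on `∅`, write `(x, lovaszExt f x)` as a convex combination of the
vertices `(χ_{A_k}, f (A_k))` (`lovaszEpigraph_subset_epiHull`).

For the facets: `epiHull f` has full dimension, so a facet cannot be annihilated by two linearly
independent functionals (`false_of_two_functionals`). If `α = 0`, the maximum of `π x` over the cube
is attained only where `x_i` is fixed for every `i` in the support of `π`, so the support is a single
element and the inequality is a bound. If `α > 0` and `π₀ > 0`, the tight sets are closed under
intersection and do not include `∅`; hence all of them contain a common element `i`
(`exists_mem_of_tight`), and the face lies in the hyperplane `x_i = 1` as well as in its own.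
-/

/-! ### Summation by parts and the greedy vector -/

/-- The greedy vector of the enumeration `σ`: the entry at `σ k` is the increment of `f` when `σ k`
is added to its predecessors. -/
def greedyVec {ι : Type*} [Fintype ι] [DecidableEq ι] (f : Finset ι → ℝ)
    (σ : Fin (Fintype.card ι) ≃ ι) (i : ι) : ℝ :=
  f ((Finset.Iic (σ.symm i)).image σ) - f ((Finset.Iio (σ.symm i)).image σ)

/-- The set of the first `k` elements in the enumeration `σ`. -/
def initialSet {ι : Type*} [Fintype ι] [DecidableEq ι] (σ : Fin (Fintype.card ι) ≃ ι) (k : ℕ) :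
    Finset ι :=
  Finset.univ.filter fun i => (σ.symm i : ℕ) < k

/-- The coordinates of `x` in the order `σ`, extended by zero to a sequence. -/
def enumSeq {ι : Type*} [Fintype ι] (σ : Fin (Fintype.card ι) ≃ ι) (x : ι → ℝ) (k : ℕ) : ℝ :=
  if h : k < Fintype.card ι then x (σ ⟨k, h⟩) else 0

theorem enumSeq_apply {ι : Type*} [Fintype ι] (σ : Fin (Fintype.card ι) ≃ ι) (x : ι → ℝ)
    (k : Fin (Fintype.card ι)) : enumSeq σ x k = x (σ k) := by
  simp [enumSeq]

theorem enumSeq_card {ι : Type*} [Fintype ι] (σ : Fin (Fintype.card ι) ≃ ι) (x : ι → ℝ) :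
    enumSeq σ x (Fintype.card ι) = 0 := by
  simp [enumSeq]

section Enumeration

variable {ι : Type*} [Fintype ι] [DecidableEq ι] (f : Finset ι → ℝ)
  (σ : Fin (Fintype.card ι) ≃ ι) (x : ι → ℝ)

theorem image_Iic_eq_initialSet (k : Fin (Fintype.card ι)) :
    (Finset.Iic k).image σ = initialSet σ (k + 1) := by
  ext i
  simp only [initialSet, Finset.mem_image, Finset.mem_Iic, Finset.mem_filter, Finset.mem_univ,
    true_and, Nat.lt_succ_iff]
  exact ⟨by rintro ⟨j, hj, rfl⟩; simpa using hj, fun h => ⟨σ.symm i, h, by simp⟩⟩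

theorem image_Iio_eq_initialSet (k : Fin (Fintype.card ι)) :
    (Finset.Iio k).image σ = initialSet σ k := by
  ext i
  simp only [initialSet, Finset.mem_image, Finset.mem_Iio, Finset.mem_filter, Finset.mem_univ,
    true_and]
  exact ⟨by rintro ⟨j, hj, rfl⟩; simpa using hj, fun h => ⟨σ.symm i, h, by simp⟩⟩

theorem greedyVec_apply (k : Fin (Fintype.card ι)) :
    greedyVec f σ (σ k) = f (initialSet σ (k + 1)) - f (initialSet σ k) := by
  simp [greedyVec, image_Iic_eq_initialSet, image_Iio_eq_initialSet]

theorem initialSet_zero : initialSet σ 0 = ∅ := by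
  simp [initialSet]

theorem initialSet_card : initialSet σ (Fintype.card ι) = Finset.univ := by
  simp [initialSet]

theorem initialSet_succ (k : Fin (Fintype.card ι)) :
    initialSet σ (k + 1) = insert (σ k) (initialSet σ k) := by
  ext i
  simp only [initialSet, Finset.mem_filter, Finset.mem_univ, true_and, Finset.mem_insert,
    Nat.lt_succ_iff_lt_or_eq, ← Fin.ext_iff, Equiv.symm_apply_eq]
  exact or_comm

theorem notMem_initialSet (k : Fin (Fintype.card ι)) : σ k ∉ initialSet σ k := by
  simp [initialSet]

theorem lovaszSum_eq_sum_fin :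
    lovaszSum f x σ = ∑ k : Fin (Fintype.card ι),
      (enumSeq σ x k - enumSeq σ x (k + 1)) * f (initialSet σ (k + 1)) := by
  unfold lovaszSum
  refine Finset.sum_congr rfl fun k _ => ?_
  rw [image_Iic_eq_initialSet, enumSeq_apply]
  rfl

theorem lovaszSum_eq_sum_greedyVec (h0 : f ∅ = 0) :
    lovaszSum f x σ = ∑ i, greedyVec f σ i * x i := by
  have key : ∀ m : ℕ, ∑ k ∈ Finset.range m,
      (enumSeq σ x k - enumSeq σ x (k + 1)) * f (initialSet σ (k + 1)) =
      ∑ k ∈ Finset.range m, (f (initialSet σ (k + 1)) - f (initialSet σ k)) * enumSeq σ x k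
        - f (initialSet σ m) * enumSeq σ x m := by
    intro m
    induction m with
    | zero => simp [initialSet_zero, h0]
    | succ m ih => rw [Finset.sum_range_succ, Finset.sum_range_succ, ih]; ring
  have hk := key (Fintype.card ι)
  rw [enumSeq_card, mul_zero, sub_zero, Finset.sum_range, Finset.sum_range] at hk
  rw [lovaszSum_eq_sum_fin, hk, ← Equiv.sum_comp σ]
  exact Finset.sum_congr rfl fun k _ => by rw [greedyVec_apply, enumSeq_apply]

/-- On a submodular function the greedy vector satisfies all inequalities `π(S) ≤ f(S)`: adding the
elements in the order `σ`, the marginal gain of an element is at least as large over `S ∩ A_k` as it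
is over `A_k`. -/
theorem greedyVec_mem (hf : IsSubmodularFn f) (h0 : f ∅ = 0) :
    greedyVec f σ ∈ associatedPolyhedron f := by
  intro S
  have key : ∀ m : ℕ, m ≤ Fintype.card ι →
      ∑ i ∈ S ∩ initialSet σ m, greedyVec f σ i ≤ f (S ∩ initialSet σ m) := by
    intro m
    induction m with
    | zero => simp [initialSet_zero, h0]
    | succ m ih =>
      intro hm
      have ih := ih (by omega)
      have hs : initialSet σ (m + 1) = insert (σ ⟨m, hm⟩) (initialSet σ m) :=
        initialSet_succ σ ⟨m, hm⟩
      have hn : σ ⟨m, hm⟩ ∉ initialSet σ m := notMem_initialSet σ ⟨m, hm⟩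
      by_cases hS : σ ⟨m, hm⟩ ∈ S
      · have hsub := hf (S ∩ initialSet σ (m + 1)) (initialSet σ m)
        have hu : S ∩ initialSet σ (m + 1) ∪ initialSet σ m = initialSet σ (m + 1) := by
          rw [hs]; grind
        have hi : S ∩ initialSet σ (m + 1) ∩ initialSet σ m = S ∩ initialSet σ m := by
          rw [hs]; grind
        have hins : S ∩ initialSet σ (m + 1) = insert (σ ⟨m, hm⟩) (S ∩ initialSet σ m) := by
          rw [hs]; grind
        have hg : greedyVec f σ (σ ⟨m, hm⟩) =
            f (initialSet σ (m + 1)) - f (initialSet σ m) := greedyVec_apply f σ ⟨m, hm⟩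
        rw [hu, hi] at hsub
        have hsum : ∑ i ∈ S ∩ initialSet σ (m + 1), greedyVec f σ i =
            greedyVec f σ (σ ⟨m, hm⟩) + ∑ i ∈ S ∩ initialSet σ m, greedyVec f σ i := by
          rw [hins]
          exact Finset.sum_insert fun h => hn (Finset.mem_inter.1 h).2
        linarith
      · rwa [hs, Finset.inter_insert_of_notMem hS]
  simpa [initialSet_card] using key _ le_rfl

/-- Applied to the set function `S ↦ χ_S(j)`, the Lovász sum returns `x_j`: the coefficients of the
sum represent `x` itself in terms of indicator vectors. -/
theorem lovaszSum_indVec (j : ι) : lovaszSum (fun S => indVec S j) x σ = x j := by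
  rw [lovaszSum_eq_sum_greedyVec _ _ _ (by simp [indVec]), Finset.sum_eq_single j]
  · obtain ⟨k, rfl⟩ := σ.surjective j
    rw [greedyVec_apply, initialSet_succ]
    simp [indVec, notMem_initialSet]
  · intro i _ hij
    obtain ⟨k, rfl⟩ := σ.surjective i
    rw [greedyVec_apply, initialSet_succ]
    simp [indVec, hij.symm]
  · simp

end Enumeration

/-! ### The convex hull, the polar and the epigraph -/

theorem mk_mem_epiHull {ι : Type*} [DecidableEq ι] {f : Finset ι → ℝ} {S : Finset ι}
    {z : ℝ} (h : f S ≤ z) :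
    (indVec S, z) ∈ epiHull f :=
  subset_convexHull ℝ _ ⟨S, rfl, h⟩

theorem convex_setOf_ineq {ι : Type*} [Fintype ι] (π : ι → ℝ) (α π₀ : ℝ) :
    Convex ℝ {p : (ι → ℝ) × ℝ | ∑ i, π i * p.1 i ≤ α * p.2 + π₀} := by
  intro p hp q hq a b ha hb hab
  simp only [Set.mem_ofPred_eq] at hp hq ⊢
  have h1 : ∑ i, π i * (a • p + b • q).1 i
      = a * ∑ i, π i * p.1 i + b * ∑ i, π i * q.1 i := by
    rw [Finset.mul_sum, Finset.mul_sum, ← Finset.sum_add_distrib]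
    exact Finset.sum_congr rfl fun i _ => by simp; ring
  have h2 : α * (a • p + b • q).2 + π₀ = a * (α * p.2 + π₀) + b * (α * q.2 + π₀) := by
    simp only [Prod.snd_add, Prod.smul_snd, smul_eq_mul]
    linear_combination (-π₀) * hab
  rw [h1, h2]
  gcongr

theorem fst_mem_Icc_of_mem_epiHull {ι : Type*} [DecidableEq ι] {f : Finset ι → ℝ}
    {p : (ι → ℝ) × ℝ} (hp : p ∈ epiHull f) :
    p.1 ∈ Set.Icc (0 : ι → ℝ) 1 := by
  have hc : Convex ℝ ((LinearMap.fst ℝ (ι → ℝ) ℝ) ⁻¹' Set.Icc (0 : ι → ℝ) 1) :=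
    (convex_Icc _ _).linear_preimage _
  refine convexHull_min ?_ hc hp
  rintro ⟨_, z⟩ ⟨S, rfl, -⟩
  refine ⟨fun i => ?_, fun i => ?_⟩ <;> simp [indVec] <;> split_ifs <;> norm_num

section Hull

variable {ι : Type*} [Fintype ι] [DecidableEq ι] {f : Finset ι → ℝ}

theorem sum_mul_indVec (π : ι → ℝ) (S : Finset ι) : ∑ i, π i * indVec S i = ∑ i ∈ S, π i := by
  simp [indVec]

/-- Validity of an inequality for `Q_f` can be tested on the generators. -/
theorem isValidIneq_epiHull {π : ι → ℝ} {α π₀ : ℝ}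
    (h : ∀ (S : Finset ι) (z : ℝ), f S ≤ z → ∑ i ∈ S, π i ≤ α * z + π₀) :
    IsValidIneq (epiHull f) π α π₀ := by
  refine fun p hp => convexHull_min ?_ (convex_setOf_ineq π α π₀) hp
  rintro ⟨_, z⟩ ⟨S, rfl, hz⟩
  simpa only [Set.mem_ofPred_eq, sum_mul_indVec] using h S z hz

theorem epiHull_subset_polar :
    epiHull f ⊆ polarPolyhedron f ∩ (Set.Icc (0 : ι → ℝ) 1 ×ˢ (Set.univ : Set ℝ)) := by
  refine fun p hp => ⟨fun π hπ => ?_, fst_mem_Icc_of_mem_epiHull hp, trivial⟩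
  have := isValidIneq_epiHull (f := f) (π := π) (α := 1) (π₀ := 0)
    (fun S z hz => by linarith [hπ S]) p hp
  linarith

theorem polar_subset_lovaszEpigraph (hf : IsSubmodularFn f) (h0 : f ∅ = 0) :
    polarPolyhedron f ∩ (Set.Icc (0 : ι → ℝ) 1 ×ˢ (Set.univ : Set ℝ)) ⊆ lovaszEpigraph f := by
  rintro p ⟨hp, hx, -⟩
  refine ⟨hx, ?_⟩
  obtain ⟨σ, hσ⟩ := exists_nonincreasing_enum p.1
  rw [lovaszExt_eq f p.1 σ hσ, lovaszSum_eq_sum_greedyVec f σ p.1 h0]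
  exact hp _ (greedyVec_mem f σ hf h0)

theorem lovaszEpigraph_subset_epiHull (h0 : f ∅ = 0) : lovaszEpigraph f ⊆ epiHull f := by
  rintro ⟨x, z⟩ ⟨⟨hx0, hx1⟩, hz⟩
  obtain ⟨σ, hσ⟩ := exists_nonincreasing_enum x
  simp only at hx0 hx1 hz
  rw [lovaszExt_eq f x σ hσ] at hz
  set t := z - lovaszSum f x σ with ht
  let c : Fin (Fintype.card ι) → ℝ := fun k => enumSeq σ x k - enumSeq σ x (k + 1)
  have hc0 : ∀ k, 0 ≤ c k := by
    intro k
    simp only [c, enumSeq_apply, sub_nonneg]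
    unfold enumSeq
    split_ifs with h
    · exact hσ (show k ≤ ⟨k + 1, h⟩ from Nat.le_succ _)
    · exact hx0 _
  have hc1 : ∑ k, c k ≤ 1 := by
    have : ∑ k, c k = enumSeq σ x 0 - enumSeq σ x (Fintype.card ι) := by
      rw [← Finset.sum_range_sub', Finset.sum_range]
    rw [this, enumSeq_card, sub_zero, enumSeq]
    split_ifs
    · exact hx1 _
    · exact zero_le_one
  -- The weight missing to `1` goes to `∅`, and every vertex is raised by the same `t`.
  let w : Option (Fin (Fintype.card ι)) → ℝ := fun o => o.elim (1 - ∑ k, c k) c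
  let A : Option (Fin (Fintype.card ι)) → Finset ι := fun o =>
    o.elim ∅ fun k => initialSet σ (k + 1)
  have hw1 : ∑ o, w o = 1 := by simp [w, Fintype.sum_option]
  have hmem : ∑ o, w o • ((indVec (A o), f (A o) + t) : (ι → ℝ) × ℝ) ∈ epiHull f := by
    refine (convex_convexHull ℝ _).sum_mem (fun o _ => ?_) hw1 fun o _ =>
      mk_mem_epiHull (by linarith)
    cases o with
    | none => exact sub_nonneg.2 hc1
    | some k => exact hc0 k
  convert hmem using 1
  refine Prod.ext ?_ ?_
  · ext j
    have := lovaszSum_indVec σ x j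
    rw [lovaszSum_eq_sum_fin] at this
    simp [Prod.fst_sum, Fintype.sum_option, w, A, c, ← this, indVec]
  · have h2 : ∑ o, w o * f (A o) = lovaszSum f x σ := by
      simp [Fintype.sum_option, w, A, c, h0, lovaszSum_eq_sum_fin]
    simp only [Prod.snd_sum, Prod.smul_snd, smul_eq_mul, mul_add, Finset.sum_add_distrib,
      ← Finset.sum_mul, hw1, h2, ht]
    ring

end Hull

/-! ### Facets -/

/-- The linear functional `(x, z) ↦ ∑ π_i x_i - α z`. -/
def ineqFunctional {ι : Type*} [Fintype ι] (π : ι → ℝ) (α : ℝ) : ((ι → ℝ) × ℝ) →ₗ[ℝ] ℝ :=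
  (Fintype.linearCombination ℝ π).comp (LinearMap.fst ℝ (ι → ℝ) ℝ) -
    α • LinearMap.snd ℝ (ι → ℝ) ℝ

theorem ineqFunctional_apply {ι : Type*} [Fintype ι] (π : ι → ℝ) (α : ℝ) (p : (ι → ℝ) × ℝ) :
    ineqFunctional π α p = ∑ i, π i * p.1 i - α * p.2 := by
  simp [ineqFunctional, Fintype.linearCombination_apply, mul_comm]

theorem vectorSpan_le_ker {E : Type*} [AddCommGroup E] [Module ℝ E] {F : Set E} {φ : E →ₗ[ℝ] ℝ}
    {c : ℝ} (h : ∀ p ∈ F, φ p = c) : vectorSpan ℝ F ≤ LinearMap.ker φ := by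
  rw [vectorSpan_def, Submodule.span_le]
  rintro _ ⟨p, hp, q, hq, rfl⟩
  simp [h p hp, h q hq]

/-- A set of codimension one cannot lie in hyperplanes of two independent functionals. -/
theorem false_of_two_functionals {E : Type*} [AddCommGroup E] [Module ℝ E] [FiniteDimensional ℝ E]
    {F : Set E} (hF : Module.finrank ℝ (vectorSpan ℝ F) + 1 = Module.finrank ℝ E)
    {φ ψ : E →ₗ[ℝ] ℝ} {c d : ℝ} (hφ : ∀ p ∈ F, φ p = c) (hψ : ∀ p ∈ F, ψ p = d)
    {u v : E} (hu : φ u = 0) (hu' : ψ u ≠ 0) (hv : φ v ≠ 0) : False := by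
  have h1 : vectorSpan ℝ F < LinearMap.ker φ :=
    (vectorSpan_le_ker hφ).lt_of_not_ge fun h => hu' (vectorSpan_le_ker hψ (h hu))
  have h2 : LinearMap.ker φ < ⊤ := lt_top_iff_ne_top.2 fun h => hv <| by
    rw [← LinearMap.mem_ker, h]; exact Submodule.mem_top
  have h3 := Submodule.finrank_lt_finrank_of_lt h1
  have h4 := Submodule.finrank_lt h2.ne
  omega

section Facets

variable {ι : Type*} [Fintype ι] [DecidableEq ι] {f : Finset ι → ℝ}

theorem vectorSpan_epiHull : vectorSpan ℝ (epiHull f) = ⊤ := by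
  have hz : ((0, 1) : (ι → ℝ) × ℝ) ∈ vectorSpan ℝ (epiHull f) := by
    have := vsub_mem_vectorSpan ℝ (mk_mem_epiHull (f := f) (S := ∅) (z := f ∅ + 1) (by linarith))
      (mk_mem_epiHull (f := f) (S := ∅) le_rfl)
    simpa using this
  have hs : ∀ r : ℝ, ((0, r) : (ι → ℝ) × ℝ) ∈ vectorSpan ℝ (epiHull f) := fun r => by
    simpa using Submodule.smul_mem _ r hz
  have hi : ∀ i, ((Pi.single i 1, 0) : (ι → ℝ) × ℝ) ∈ vectorSpan ℝ (epiHull f) := by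
    intro i
    have h := vsub_mem_vectorSpan ℝ (mk_mem_epiHull (f := f) (S := {i}) le_rfl)
      (mk_mem_epiHull (f := f) (S := ∅) le_rfl)
    convert Submodule.sub_mem _ h (hs (f {i} - f ∅)) using 1
    ext j <;> simp [indVec, Pi.single_apply]
  rw [eq_top_iff]
  rintro ⟨x, z⟩ -
  have : ((x, z) : (ι → ℝ) × ℝ) = ∑ i, x i • ((Pi.single i 1, 0) : (ι → ℝ) × ℝ) + (0, z) := by
    ext j <;> simp [Prod.fst_sum, Prod.snd_sum, Finset.sum_apply, Pi.single_apply]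
  rw [this]
  exact Submodule.add_mem _ (Submodule.sum_mem _ fun i _ => Submodule.smul_mem _ _ (hi i)) (hs z)

theorem finrank_face_of_isFacetDefining {π : ι → ℝ} {α π₀ : ℝ}
    (h : IsFacetDefining (epiHull f) π α π₀) :
    Module.finrank ℝ (vectorSpan ℝ (ineqFace (epiHull f) π α π₀)) + 1 =
      Module.finrank ℝ ((ι → ℝ) × ℝ) := by
  rw [h.2.2, vectorSpan_epiHull, finrank_top]

theorem coeff_nonneg_of_isValidIneq {π : ι → ℝ} {α π₀ : ℝ}
    (h : IsValidIneq (epiHull f) π α π₀) : 0 ≤ α := by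
  by_contra! hα
  -- Along the ray `(0, z)`, `z → ∞`, the right-hand side becomes negative.
  have h1 := h _ (mk_mem_epiHull (f := f) (S := ∅) (z := max (f ∅) ((-π₀ - 1) / α))
    (le_max_left _ _))
  have h2 := mul_le_mul_of_nonpos_left (le_max_right (f ∅) ((-π₀ - 1) / α)) hα.le
  rw [mul_div_cancel₀ _ hα.ne] at h2
  simp only [sum_mul_indVec, Finset.sum_empty] at h1
  linarith

/-- On the face of a valid inequality with `α = 0`, every coordinate in the support of `π` is fixed:
at `1` if `π_i > 0` and at `0` if `π_i < 0`. -/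
theorem coord_eq_of_mem_ineqFace {π : ι → ℝ} {π₀ : ℝ} (h : IsValidIneq (epiHull f) π 0 π₀)
    {p : (ι → ℝ) × ℝ} (hp : p ∈ ineqFace (epiHull f) π 0 π₀) {i : ι} (hi : π i ≠ 0) :
    p.1 i = if 0 < π i then 1 else 0 := by
  obtain ⟨hx0, hx1⟩ := fst_mem_Icc_of_mem_epiHull hp.1
  have hle : ∀ j ∈ Finset.univ, π j * p.1 j ≤ π j * indVec (Finset.univ.filter (0 < π ·)) j := by
    intro j _
    simp only [indVec, Finset.mem_filter, Finset.mem_univ, true_and]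
    have h0 := hx0 j
    have h1 := hx1 j
    simp only [Pi.zero_apply, Pi.one_apply] at h0 h1
    split_ifs <;> nlinarith
  have hval := h _ (mk_mem_epiHull (f := f) (S := Finset.univ.filter (0 < π ·)) le_rfl)
  have heq : ∑ j, π j * p.1 j = ∑ j, π j * indVec (Finset.univ.filter (0 < π ·)) j := by
    refine le_antisymm (Finset.sum_le_sum hle) ?_
    have := hp.2
    simp only [zero_mul] at this hval
    linarith
  have := mul_left_cancel₀ hi ((Finset.sum_eq_sum_iff_of_le hle).1 heq i (Finset.mem_univ i))
  simpa [indVec] using this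

theorem isTrivialIneq_of_coeff_eq_zero {π : ι → ℝ} {π₀ : ℝ}
    (h : IsFacetDefining (epiHull f) π 0 π₀) : IsTrivialIneq π 0 π₀ := by
  have hdim := finrank_face_of_isFacetDefining h
  obtain ⟨p, hp⟩ := h.2.1
  have hpos : ∃ i, π i ≠ 0 := by
    by_contra! hz
    have hπ₀ : π₀ = 0 := by simpa [hz] using hp.2.symm
    have hface : ineqFace (epiHull f) π 0 π₀ = epiHull f := by
      ext q
      simp [ineqFace, hz, hπ₀]
    rw [hface, vectorSpan_epiHull, finrank_top] at hdim
    omega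
  obtain ⟨i, hi⟩ := hpos
  have huniq : ∀ j, j ≠ i → π j = 0 := by
    intro j hji
    by_contra hj
    refine false_of_two_functionals hdim
      (φ := (LinearMap.proj i).comp (LinearMap.fst ℝ (ι → ℝ) ℝ))
      (ψ := (LinearMap.proj j).comp (LinearMap.fst ℝ (ι → ℝ) ℝ))
      (fun q hq => coord_eq_of_mem_ineqFace h.1 hq hi)
      (fun q hq => coord_eq_of_mem_ineqFace h.1 hq hj)
      (u := (Pi.single j 1, 0)) (v := (Pi.single i 1, 0)) ?_ ?_ ?_ <;>
    simp [hji.symm]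
  have hπ : π = Pi.single i (π i) := by
    ext j
    by_cases hji : j = i
    · subst hji; simp
    · simp [hji, huniq j hji]
  have hsum : π i * p.1 i = π₀ := by
    have h2 := hp.2
    rw [Finset.sum_eq_single i (fun j _ hj => by simp [huniq j hj]) (by simp)] at h2
    simpa using h2
  rw [coord_eq_of_mem_ineqFace h.1 hp hi] at hsum
  rcases lt_or_gt_of_ne hi with hneg | hpos
  · refine ⟨i, -π i, by linarith, rfl, Or.inl ⟨by rwa [neg_neg], ?_⟩⟩
    simpa [hneg.not_gt] using hsum.symm
  · refine ⟨i, π i, hpos, rfl, Or.inr ⟨hπ, ?_⟩⟩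
    simpa [hpos] using hsum.symm

/-- If `g` is nonnegative and submodular with `g ∅ > 0`, then the zeros of `g` have a common element,
because they are closed under intersection. -/
theorem exists_mem_of_tight {g : Finset ι → ℝ} (hg : IsSubmodularFn g) (hnn : ∀ S, 0 ≤ g S)
    (h0 : 0 < g ∅) {S₀ : Finset ι} (hS₀ : g S₀ = 0) : ∃ i, ∀ S, g S = 0 → i ∈ S := by
  obtain ⟨M, hM, hmin⟩ := (Finset.univ.filter fun S => g S = 0).exists_min_image Finset.card
    ⟨S₀, by simpa using hS₀⟩
  simp only [Finset.mem_filter, Finset.mem_univ, true_and] at hM hmin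
  obtain ⟨i, hi⟩ : M.Nonempty := by
    rw [Finset.nonempty_iff_ne_empty]
    rintro rfl
    exact h0.ne' hM
  refine ⟨i, fun S hS => ?_⟩
  have hMS : g (M ∩ S) = 0 := by
    linarith [hg M S, hnn (M ∪ S), hnn (M ∩ S)]
  have := Finset.eq_of_subset_of_card_le Finset.inter_subset_left (hmin _ hMS)
  rw [← this] at hi
  exact (Finset.mem_inter.1 hi).2

theorem rhs_eq_zero_of_isFacetDefining (hf : IsSubmodularFn f) (h0 : f ∅ = 0) {π : ι → ℝ}
    {α π₀ : ℝ} (hα : 0 < α) (h : IsFacetDefining (epiHull f) π α π₀) : π₀ = 0 := by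
  have hdim := finrank_face_of_isFacetDefining h
  have hvalid : ∀ S : Finset ι, ∑ i ∈ S, π i ≤ α * f S + π₀ := fun S => by
    simpa only [sum_mul_indVec] using h.1 _ (mk_mem_epiHull (f := f) (S := S) le_rfl)
  by_contra hne
  have hπ₀ : 0 < π₀ := lt_of_le_of_ne (by simpa [h0] using hvalid ∅) (Ne.symm hne)
  -- `g` is the slack of the inequality at the vertex of `S`.
  let g : Finset ι → ℝ := fun S => α * f S + π₀ - ∑ i ∈ S, π i
  have hg : IsSubmodularFn g := by
    intro S T
    have h1 := mul_le_mul_of_nonneg_left (hf S T) hα.le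
    have h2 := Finset.sum_union_inter (s₁ := S) (s₂ := T) (f := π)
    simp only [g]
    linarith
  have hnn : ∀ S, 0 ≤ g S := fun S => sub_nonneg.2 (hvalid S)
  have hg0 : 0 < g ∅ := by simpa [g, h0] using hπ₀
  -- There are finitely many sets, so positive slacks are bounded away from zero.
  have hgap : ∀ D : Finset (Finset ι), (∀ S ∈ D, 0 < g S) → ∃ ε > 0, ∀ S ∈ D, ε ≤ g S := by
    intro D hD
    rcases D.eq_empty_or_nonempty with rfl | hne
    · exact ⟨1, one_pos, by simp⟩
    · obtain ⟨M, hM, hmin⟩ := D.exists_min_image g hne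
      exact ⟨g M, hD M hM, hmin⟩
  obtain ⟨p, hp⟩ := h.2.1
  have htight : ∃ S, g S = 0 := by
    by_contra! hno
    obtain ⟨ε, hε, hle⟩ := hgap Finset.univ fun S _ => lt_of_le_of_ne (hnn S) (Ne.symm (hno S))
    have := isValidIneq_epiHull (f := f) (π := π) (α := α) (π₀ := π₀ - ε) (fun S z hz => by
      have h1 := hle S (Finset.mem_univ S)
      have h2 := mul_le_mul_of_nonneg_left hz hα.le
      simp only [g] at h1
      linarith) p hp.1
    linarith [hp.2]
  obtain ⟨S₀, hS₀⟩ := htight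
  obtain ⟨i, hi⟩ := exists_mem_of_tight hg hnn hg0 hS₀
  obtain ⟨ε, hε, hle⟩ := hgap (Finset.univ.filter fun S => i ∉ S) fun S hS =>
    lt_of_le_of_ne (hnn S) fun h => (Finset.mem_filter.1 hS).2 (hi S h.symm)
  -- The strengthened inequality `π x + ε (1 - x_i) ≤ α z + π₀` is still valid.
  have hstrong : IsValidIneq (epiHull f) (π - Pi.single i ε) α (π₀ - ε) := by
    refine isValidIneq_epiHull fun S z hz => ?_
    have h2 := mul_le_mul_of_nonneg_left hz hα.le
    have hs : ∑ j ∈ S, (π - Pi.single i ε : ι → ℝ) j = ∑ j ∈ S, π j - if i ∈ S then ε else 0 := by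
      simp [Finset.sum_sub_distrib]
    rw [hs]
    split_ifs with hiS
    · linarith [hvalid S]
    · have h1 := hle S (by simpa using hiS)
      simp only [g] at h1
      linarith
  have hone : ∀ q ∈ ineqFace (epiHull f) π α π₀, q.1 i = 1 := by
    intro q hq
    have h1 := hstrong q hq.1
    have hs : ∑ j, (π - Pi.single i ε : ι → ℝ) j * q.1 j = ∑ j, π j * q.1 j - ε * q.1 i := by
      simp [sub_mul, Finset.sum_sub_distrib, Pi.single_apply]
    rw [hs, hq.2] at h1
    exact le_antisymm ((fst_mem_Icc_of_mem_epiHull hq.1).2 i)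
      (le_of_mul_le_mul_left (by linarith) hε)
  refine false_of_two_functionals hdim
    (φ := (LinearMap.proj i).comp (LinearMap.fst ℝ (ι → ℝ) ℝ)) (ψ := ineqFunctional π α)
    (d := π₀) (fun q hq => hone q hq)
    (fun q hq => by rw [ineqFunctional_apply, hq.2]; ring)
    (u := (0, 1)) (v := (Pi.single i 1, 0)) (by simp)
    (by simpa [ineqFunctional_apply] using hα.ne') (by simp)

end Facets

theorem proposition4 {ι : Type*} [Fintype ι] [DecidableEq ι] (f : Finset ι → ℝ)
    (hf : IsSubmodularFn f) (h0 : f ∅ = 0) :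
    (∀ (π : ι → ℝ) (α π₀ : ℝ), IsFacetDefining (epiHull f) π α π₀ →
      ¬ IsTrivialIneq π α π₀ → 0 < α ∧ π₀ = 0) ∧
    epiHull f = polarPolyhedron f ∩ (Set.Icc (0 : ι → ℝ) 1 ×ˢ (Set.univ : Set ℝ)) ∧
    epiHull f = lovaszEpigraph f := by
  have h1 := epiHull_subset_polar (f := f)
  have h2 := polar_subset_lovaszEpigraph hf h0
  have h3 := lovaszEpigraph_subset_epiHull h0
  refine ⟨fun π α π₀ hfac htriv => ?_, h1.antisymm (h2.trans h3), (h1.trans h2).antisymm h3⟩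
  have hα : 0 < α := by
    refine lt_of_le_of_ne (coeff_nonneg_of_isValidIneq hfac.1) ?_
    rintro rfl
    exact htriv (isTrivialIneq_of_coeff_eq_zero hfac)
  exact ⟨hα, rhs_eq_zero_of_isFacetDefining hf h0 hα hfac⟩
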